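/- Let $Y_1,Y_3,Y_5,\dots$ be free non-commuting symbols, let $h$ be a formal (central) variable, and put $Y(h)=\sum_{k\ge 0}h^{2k+1}Y_{2k+1}$; then $e^{Y(h)}$ is the series of operators of a time-symmetric second-order integrator $S_h$ for $x'=f(x)$, where $Y_1$ is the Lie derivative of $f$. For $a\in\mathbb R$ define $W(h)=W(h;a)$ by $$e^{Y(ah)}e^{Y((1-2a)h)}e^{Y(ah)}=e^{\frac h2Y_1}\,e^{h^3W(h)}\,e^{\frac h2Y_1}.$$ With $E_{31}=Y_3$, $E_{41}=[Y_1,E_{31}]$, $E_{51}=Y_5$, $E_{52}=[Y_1,E_{41}]$, $E_{61}=[Y_1,E_{51}]$, $E_{62}=[Y_1,E_{52}]$, $E_{71}=Y_7$, $E_{72}=[Y_1,E_{61}]$, $E_{73}=[Y_1,E_{62}]$, $E_{74}=[E_{31},E_{41}]$, there are unique real numbers $w_{mn}(a)$ such that $h^3W(h)=\sum_{m=3}^{7}h^m\sum_n w_{mn}(a)E_{mn}+\mathcal O(h^8)$. Let $k\in\mathbb N$ and $a_1,\dots,a_k,b_1,\dots,b_k\in\mathbb R$, and consider the method $$\psi_h=\sum_{i=1}^k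 b_i\,S_{a_ih}\circ S_{(1-2a_i)h}\circ S_{a_ih}.$$ Put $G_{00}=\sum_i b_i$, $G_{mn}=\sum_i b_iw_{mn}(a_i)$, $\tilde G_{63}=\sum_i b_iw_{31}(a_i)^2$, $\tilde G_{87}=\sum_i b_iw_{31}(a_i)w_{51}(a_i)$, $\tilde G_{88}=\sum_i b_iw_{31}(a_i)w_{52}(a_i)$. (1) Suppose that the sixth-order conditions $G_{00}=1$, $G_{31}=G_{51}=G_{52}=\tilde G_{63}=0$ hold. Then $$G_{72}=-\tfrac{5}{4536}+\tfrac{5}{126}G_{71},\qquad G_{73}=-\tfrac1{90720}+\tfrac1{2520}G_{71},\qquad G_{74}=-\tfrac1{648}+\tfrac1{18}G_{71},$$ $$-\tfrac1{15}\Bigl(\tfrac12\tilde G_{87}\Bigr)+2\Bigl(\tfrac12\tilde G_{88}\Bigr)+\tfrac1{30}G_{71}+G_{72}+6G_{73}-\tfrac32G_{74}=0.$$ In particular, if $G_{71}=0$, then $\tilde G_{87}$ and $\tilde G_{88}$ do not both vanish; and if $G_{72}=G_{73}=G_{74}=0$, then $G_{71}=\frac1{36}$. (2) The method never has order 7, for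 any $k$ and any $a_i,b_i$. This holds formally, that is, the identity $\sum_i b_i\,e^{Y(a_ih)}e^{Y((1-2a_i)h)}e^{Y(a_ih)}=e^{hY_1}+\mathcal O(h^8)$ of formal series fails. It also holds for differential equations: it is not the case that $\psi_h(x)=\varphi_h(x)+\mathcal O(h^8)$ as $h\to0$ for every $d$, every smooth vector field on $\mathbb R^d$ with a global flow $\varphi_t$, every smooth globally defined time-symmetric integrator $S_h$ of order 2 for it, and every $x\in\mathbb R^d$. -/

import Mathlib

open scoped ContDiff Topology

noncomputable section

namespace PalComp

/-! ### Formal series of operators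

The operators `Y₁, Y₃, Y₅, …` of a time-symmetric basic scheme are the free generators of
`FreeAlgebra ℝ ℕ`, the `k`-th generator being `Y_{2k+1}`; the free Lie algebra they generate is
the Lie subalgebra generated by them for the commutator bracket. -/

/-- The associative algebra of noncommutative polynomials in `Y₁, Y₃, Y₅, …`. -/
abbrev Op : Type := FreeAlgebra ℝ ℕ

/-- Formal power series in the step size `h` with coefficients in `Op` (`h` is central). -/
abbrev OpSeries : Type := PowerSeries Op

/-- The generator `Y_{2k+1}`. -/
def Y (k : ℕ) : Op := FreeAlgebra.ι ℝ k

/-- `exp f = ∑ₖ f ^ k / k!`, for a series `f` without constant term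
(`f ^ k` has no term in `h ^ n` for `k > n`). -/
def fexp (f : OpSeries) : OpSeries :=
  PowerSeries.mk fun n => ∑ k ∈ Finset.range (n + 1), ((k.factorial : ℝ)⁻¹) • PowerSeries.coeff n (f ^ k)

/-- `log f = ∑_{k ≥ 1} (-1) ^ (k + 1) (f - 1) ^ k / k`, for a series `f` with constant term `1`. -/
def flog (f : OpSeries) : OpSeries :=
  PowerSeries.mk fun n =>
    ∑ k ∈ Finset.Icc 1 n, ((-1 : ℝ) ^ (k + 1) / (k : ℝ)) • PowerSeries.coeff n ((f - 1) ^ k)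

/-- `Y(c h) = ∑ₖ (c h) ^ (2 k + 1) Y_{2k+1}`. -/
def Yser (c : ℝ) : OpSeries :=
  PowerSeries.mk fun n => if Odd n then (c ^ n) • Y (n / 2) else 0

/-- The series `e ^ {Y(c h)}` associated with the basic map `S_{c h}`. -/
def basicSeries (c : ℝ) : OpSeries := fexp (Yser c)

/-- The series `e ^ {c h Y₁}` associated with the flow at time `c h`. -/
def flowSeries (c : ℝ) : OpSeries := fexp (PowerSeries.monomial 1 (c • Y 0))

/-- The series of the palindromic composition `S_{a h} ∘ S_{(1 - 2 a) h} ∘ S_{a h}`. -/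
def compSeries (a : ℝ) : OpSeries :=
  basicSeries a * basicSeries (1 - 2 * a) * basicSeries a

/-- The series `Ψ(h)` of the linear combination `∑ i, b i • S_{aᵢ h} ∘ S_{(1 - 2 aᵢ) h} ∘ S_{aᵢ h}`. -/
def methodSeries {k : ℕ} (b a : Fin k → ℝ) : OpSeries := ∑ i, b i • compSeries (a i)

/-- The series `h³ W(h)` defined by
`e ^ {Y(a h)} e ^ {Y((1 - 2 a) h)} e ^ {Y(a h)} = e ^ {h Y₁ / 2} e ^ {h³ W(h)} e ^ {h Y₁ / 2}`. -/
def logSeries (a : ℝ) : OpSeries :=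
  flog (flowSeries (-1 / 2) * compSeries a * flowSeries (-1 / 2))

/-! ### The basis of the free Lie algebra in degrees 3 to 7 -/

def E31 : Op := Y 1
def E41 : Op := ⁅Y 0, E31⁆
def E51 : Op := Y 2
def E52 : Op := ⁅Y 0, E41⁆
def E61 : Op := ⁅Y 0, E51⁆
def E62 : Op := ⁅Y 0, E52⁆
def E71 : Op := Y 3
def E72 : Op := ⁅Y 0, E61⁆
def E73 : Op := ⁅Y 0, E62⁆
def E74 : Op := ⁅E31, E41⁆

/-- A list of coordinates `w_{mn}`, `3 ≤ m ≤ 7`, one for each basis element `E_{mn}`. -/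
@[ext] structure LieCoeffs : Type where
  w31 : ℝ
  w41 : ℝ
  w51 : ℝ
  w52 : ℝ
  w61 : ℝ
  w62 : ℝ
  w71 : ℝ
  w72 : ℝ
  w73 : ℝ
  w74 : ℝ

instance : Inhabited LieCoeffs := ⟨⟨0, 0, 0, 0, 0, 0, 0, 0, 0, 0⟩⟩

/-- `h³ W(h) = ∑_{3 ≤ m ≤ 7} h ^ m ∑ₙ w_{mn} E_{mn} + O(h ^ 8)`. -/
structure IsLogExpansion (a : ℝ) (v : LieCoeffs) : Prop where
  deg0 : PowerSeries.coeff 0 (logSeries a) = 0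
  deg1 : PowerSeries.coeff 1 (logSeries a) = 0
  deg2 : PowerSeries.coeff 2 (logSeries a) = 0
  deg3 : PowerSeries.coeff 3 (logSeries a) = v.w31 • E31
  deg4 : PowerSeries.coeff 4 (logSeries a) = v.w41 • E41
  deg5 : PowerSeries.coeff 5 (logSeries a) = v.w51 • E51 + v.w52 • E52
  deg6 : PowerSeries.coeff 6 (logSeries a) = v.w61 • E61 + v.w62 • E62
  deg7 : PowerSeries.coeff 7 (logSeries a) =
    v.w71 • E71 + v.w72 • E72 + v.w73 • E73 + v.w74 • E74

/-- The coordinates `w_{mn}(a)` of `h³ W(h)` in the basis `E_{mn}`. That they exist and are unique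
is part of the theorem. -/
def w (a : ℝ) : LieCoeffs := Classical.epsilon (IsLogExpansion a)

section Coefficients

variable {k : ℕ} (b a : Fin k → ℝ)

def G00 : ℝ := ∑ i, b i
def G31 : ℝ := ∑ i, b i * (w (a i)).w31
def G51 : ℝ := ∑ i, b i * (w (a i)).w51
def G52 : ℝ := ∑ i, b i * (w (a i)).w52
def G71 : ℝ := ∑ i, b i * (w (a i)).w71
def G72 : ℝ := ∑ i, b i * (w (a i)).w72
def G73 : ℝ := ∑ i, b i * (w (a i)).w73
def G74 : ℝ := ∑ i, b i * (w (a i)).w74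
def Gt63 : ℝ := ∑ i, b i * (w (a i)).w31 ^ 2
def Gt87 : ℝ := ∑ i, b i * ((w (a i)).w31 * (w (a i)).w51)
def Gt88 : ℝ := ∑ i, b i * ((w (a i)).w31 * (w (a i)).w52)

/-- The order conditions of a sixth-order method. -/
structure OrderSixConditions : Prop where
  g00 : G00 b = 1
  g31 : G31 b a = 0
  g51 : G51 b a = 0
  g52 : G52 b a = 0
  g63 : Gt63 b a = 0

end Coefficients

/-- Formal order `p`: `Ψ(h) = e ^ {h Y₁} + O(h ^ (p + 1))` as formal series of operators. -/
def HasFormalOrder {k : ℕ} (p : ℕ) (b a : Fin k → ℝ) : Prop :=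
  ∀ n ≤ p, PowerSeries.coeff n (methodSeries b a) = PowerSeries.coeff n (flowSeries 1)

/-! ### Numerical order on differential equations -/

/-- `φ` is the (global) flow of `x' = f x`. -/
structure IsFlow {d : ℕ} (f : EuclideanSpace ℝ (Fin d) → EuclideanSpace ℝ (Fin d))
    (φ : ℝ → EuclideanSpace ℝ (Fin d) → EuclideanSpace ℝ (Fin d)) : Prop where
  zero : ∀ x, φ 0 x = x
  deriv : ∀ t x, HasDerivAt (fun s => φ s x) (f (φ t x)) t

/-- `S` is a smooth time-symmetric integrator of order 2 for the equation with flow `φ`. -/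
structure IsBasicScheme {d : ℕ} (φ S : ℝ → EuclideanSpace ℝ (Fin d) → EuclideanSpace ℝ (Fin d)) :
    Prop where
  smooth : ContDiff ℝ ∞ fun p : ℝ × EuclideanSpace ℝ (Fin d) => S p.1 p.2
  symmetric : ∀ h x, S (-h) (S h x) = x
  order_two : ∀ x, (fun h : ℝ => S h x - φ h x) =O[𝓝 0] fun h : ℝ => h ^ 3

/-- The map `ψ_h = ∑ i, b i • S_{aᵢ h} ∘ S_{(1 - 2 aᵢ) h} ∘ S_{aᵢ h}`. -/
def method {k d : ℕ} (b a : Fin k → ℝ)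
    (S : ℝ → EuclideanSpace ℝ (Fin d) → EuclideanSpace ℝ (Fin d)) (h : ℝ)
    (x : EuclideanSpace ℝ (Fin d)) : EuclideanSpace ℝ (Fin d) :=
  ∑ i, b i • S (a i * h) (S ((1 - 2 * a i) * h) (S (a i * h) x))

/-- The method has order `p`: `ψ_h(x) = φ_h(x) + O(h ^ (p + 1))` for every smooth vector field with
a global flow and every smooth globally defined time-symmetric basic integrator of order 2. (This
definition is only used to deny an order, so restricting to global objects strengthens the claim.) -/
def HasOrder {k : ℕ} (p : ℕ) (b a : Fin k → ℝ) : Prop :=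
  ∀ (d : ℕ) (f : EuclideanSpace ℝ (Fin d) → EuclideanSpace ℝ (Fin d))
    (φ S : ℝ → EuclideanSpace ℝ (Fin d) → EuclideanSpace ℝ (Fin d)),
    ContDiff ℝ ∞ f → IsFlow f φ → IsBasicScheme φ S →
    ∀ x, (fun h : ℝ => method b a S h x - φ h x) =O[𝓝 0] fun h : ℝ => h ^ (p + 1)

end PalComp

end

/-!
Write `F(c) = e^{c h Y₁}`. A direct expansion shows that `F(-c/2) e^{Y(c h)} F(-c/2)` has only a few
terms up to `O(h⁸)`: it is `coreSeries c`, the exponential of an odd series without linear term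
(`basicSeries_agreeTo`). Substituting this for the three factors of the palindromic composition and
collecting the flows gives
`F(-1/2) e^{Y(a h)} e^{Y((1 - 2 a) h)} e^{Y(a h)} F(-1/2) =
  (F(-s) core(a) F(s)) core(1 - 2 a) (F(s) core(a) F(-s))`, `s = (1 - a) / 2`,
where conjugation by `F(± s)` is the exponential of `± s h ad Y₁` (`flow_conj_coreSeries`). This
product of sparse series is multiplied out in `ad_core_ad`. As its nonconstant
terms start in degree 3, only two terms of the logarithm matter up to degree 7, and the coordinates
`w_{mn}(a)` come out as the polynomials `wPoly a`. They are unique because suitable word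
coefficients separate the `E_{mn}` (`wordCoeff_E`).

The linear relations are then identities between polynomials in a single variable `a`, summed with
weights `b i`: modulo `w₃₁`, `w₅₁`, `w₅₂`, `w₃₁²`, each of `w₇₂`, `w₇₃`, `w₇₄` is an affine function
of `w₇₁`. Formal order seven would force the sixth-order conditions and `G₇₁ = G₇₂ = 0`, which
contradicts the relation for `G₇₂`, whose constant term is not zero.

For differential equations it suffices to test two kinds of integrators of constant vector fields in
the plane whose maps are shears, with everything polynomial in `h`:
`(p, q) ↦ (p + h, q + h ^ m (p + h / 2) ^ j)` with `m` odd, for which the method at the origin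
differs from the flow by a single monomial `h ^ (m + j)` in the second coordinate, and
`(p, q) ↦ (p + h³, q + h³ p + h⁶ / 2)`, which sees `∑ b i w₃₁(a i) ^ 2`. Order seven makes six
weighted sums of polynomials in the `a i` vanish (`HasOrder.moment_eq_zero`,
`HasOrder.sum_sq_eq_zero`); the constant `1` is a linear combination of these polynomials, so
`∑ b i = 0`, whereas consistency requires `∑ b i = 1`.
-/

noncomputable section

namespace PalComp

section Series

open PowerSeries

/-! ### Congruence of power series up to a given degree -/

/-- Two power series agree up to and including degree `N`. -/
def AgreeTo {R : Type*} [Semiring R] (N : ℕ) (f g : PowerSeries R) : Prop :=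
  ∀ n ≤ N, coeff n f = coeff n g

namespace AgreeTo
variable {R : Type*} [Semiring R] {N : ℕ} {f g f' g' : PowerSeries R}

lemma refl (f : PowerSeries R) : AgreeTo N f f := fun _ _ => rfl

lemma trans {k : PowerSeries R} (h : AgreeTo N f g) (h' : AgreeTo N g k) : AgreeTo N f k :=
  fun n hn => (h n hn).trans (h' n hn)

lemma mul (h : AgreeTo N f g) (h' : AgreeTo N f' g') : AgreeTo N (f * f') (g * g') := by
  intro n hn
  rw [coeff_mul, coeff_mul]
  refine Finset.sum_congr rfl fun p hp => ?_
  have := Finset.HasAntidiagonal.mem_antidiagonal.1 hp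
  rw [h p.1 (by omega), h' p.2 (by omega)]

lemma pow (h : AgreeTo N f g) (k : ℕ) : AgreeTo N (f ^ k) (g ^ k) := by
  induction k with
  | zero => simpa using refl (1 : PowerSeries R)
  | succ k ih => simpa only [pow_succ] using ih.mul h

lemma sub {R : Type*} [Ring R] {f g f' g' : PowerSeries R} (h : AgreeTo N f g)
    (h' : AgreeTo N f' g') : AgreeTo N (f - f') (g - g') := fun n hn => by
  rw [map_sub, map_sub, h n hn, h' n hn]

lemma flog {f g : OpSeries} (h : AgreeTo N f g) : AgreeTo N (flog f) (flog g) := by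
  intro n hn
  rw [PalComp.flog, PalComp.flog, coeff_mk, coeff_mk]
  refine Finset.sum_congr rfl fun k _ => ?_
  rw [((h.sub (refl 1)).pow k) n hn]

end AgreeTo

/-! ### Coefficients of the flow series -/

lemma monomial_one_pow {R : Type*} [Semiring R] (r : R) (k : ℕ) :
    (monomial 1 r : PowerSeries R) ^ k = monomial k (r ^ k) := by
  induction k with
  | zero => rw [pow_zero, pow_zero, monomial_zero_eq_C_apply, map_one]
  | succ k ih => rw [pow_succ, ih, monomial_mul_monomial, pow_succ]

/-- The Cauchy product in the form in which `Finset.sum_range_succ` evaluates it. -/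
lemma coeff_mul_range {R : Type*} [Semiring R] (n : ℕ) (f g : PowerSeries R) :
    coeff n (f * g) = ∑ i ∈ Finset.range (n + 1), coeff i f * coeff (n - i) g := by
  rw [coeff_mul, Finset.Nat.sum_antidiagonal_eq_sum_range_succ
    (fun i j => coeff i f * coeff j g)]

lemma coeff_flowSeries (c : ℝ) (n : ℕ) :
    coeff n (flowSeries c) = (c ^ n / n.factorial) • Y 0 ^ n := by
  rw [flowSeries, fexp, coeff_mk, Finset.sum_eq_single n]
  · rw [monomial_one_pow, PowerSeries.coeff_monomial_same, smul_pow, smul_smul]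
    congr 1; ring
  · intro k _ hk
    rw [monomial_one_pow, PowerSeries.coeff_monomial, if_neg (Ne.symm hk),
      smul_zero]
  · simp

lemma flowSeries_mul (s t : ℝ) : flowSeries s * flowSeries t = flowSeries (s + t) := by
  ext n
  simp only [coeff_mul, coeff_flowSeries, smul_mul_smul_comm]
  rw [Finset.sum_congr rfl (g := fun p : ℕ × ℕ =>
    (s ^ p.1 / p.1.factorial * (t ^ p.2 / p.2.factorial)) • Y 0 ^ n)]
  · rw [← Finset.sum_smul, (Commute.all s t).add_pow', Finset.sum_div]
    congr 1
    refine Finset.sum_congr rfl fun p hp => ?_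
    obtain rfl := Finset.HasAntidiagonal.mem_antidiagonal.1 hp
    rw [← Nat.add_choose_mul_factorial_mul_factorial p.1 p.2]
    have h1 : ((p.1 + p.2).choose p.2 : ℝ) ≠ 0 := by
      exact_mod_cast (Nat.choose_pos (Nat.le_add_left _ _)).ne'
    push_cast
    rw [nsmul_eq_mul, Nat.choose_symm_add]
    field_simp
  · intro p hp
    rw [← Finset.HasAntidiagonal.mem_antidiagonal.1 hp, pow_add]

lemma flowSeries_zero : flowSeries 0 = 1 := by
  ext n
  rcases eq_or_ne n 0 with rfl | hn
  · simp [coeff_flowSeries]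
  · simp [coeff_flowSeries, hn, coeff_one]

/-! ### The core of the basic scheme -/

lemma coeff_Yser (c : ℝ) :
    coeff 0 (Yser c) = 0 ∧ coeff 1 (Yser c) = c • Y 0 ∧ coeff 2 (Yser c) = 0 ∧
    coeff 3 (Yser c) = c ^ 3 • Y 1 ∧ coeff 4 (Yser c) = 0 ∧ coeff 5 (Yser c) = c ^ 5 • Y 2 ∧
    coeff 6 (Yser c) = 0 ∧ coeff 7 (Yser c) = c ^ 7 • Y 3 := by
  refine ⟨?_, ?_, ?_, ?_, ?_, ?_, ?_, ?_⟩ <;> rw [Yser, coeff_mk]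
  all_goals first | exact if_neg (by decide) | exact (if_pos (by decide)).trans (by simp)

/-- The Cauchy product with the sparse series `Yser c`. -/
lemma coeff_Yser_mul (c : ℝ) (g : OpSeries) :
    coeff 0 (Yser c * g) = 0 ∧
    coeff 1 (Yser c * g) = c • (Y 0 * coeff 0 g) ∧
    coeff 2 (Yser c * g) = c • (Y 0 * coeff 1 g) ∧
    coeff 3 (Yser c * g) = c • (Y 0 * coeff 2 g) + c ^ 3 • (Y 1 * coeff 0 g) ∧
    coeff 4 (Yser c * g) = c • (Y 0 * coeff 3 g) + c ^ 3 • (Y 1 * coeff 1 g) ∧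
    coeff 5 (Yser c * g) = c • (Y 0 * coeff 4 g) + c ^ 3 • (Y 1 * coeff 2 g)
      + c ^ 5 • (Y 2 * coeff 0 g) ∧
    coeff 6 (Yser c * g) = c • (Y 0 * coeff 5 g) + c ^ 3 • (Y 1 * coeff 3 g)
      + c ^ 5 • (Y 2 * coeff 1 g) ∧
    coeff 7 (Yser c * g) = c • (Y 0 * coeff 6 g) + c ^ 3 • (Y 1 * coeff 4 g)
      + c ^ 5 • (Y 2 * coeff 2 g) + c ^ 7 • (Y 3 * coeff 0 g) := by
  obtain ⟨y0, y1, y2, y3, y4, y5, y6, y7⟩ := coeff_Yser c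
  simp [coeff_mul_range, Finset.sum_range_succ, y0, y1, y2, y3, y4, y5, y6, y7,
    -coeff_zero_eq_constantCoeff]

/-- The series `1 + h³ L₃ + h⁵ L₅ + h⁶ L₃² / 2 + h⁷ L₇`, where `h³ L₃ + h⁵ L₅ + h⁷ L₇` is, up to
`O(h⁸)`, the logarithm of `e^{-c h Y₁ / 2} e^{Y(c h)} e^{-c h Y₁ / 2}`. -/
def coreSeries (c : ℝ) : OpSeries :=
  PowerSeries.mk fun n => match n with
    | 0 => 1
    | 3 => c ^ 3 • E31
    | 5 => c ^ 5 • (E51 + (1 / 24 : ℝ) • E52)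
    | 6 => (c ^ 6 / 2) • (E31 * E31)
    | 7 => c ^ 7 • (E71 + (1 / 24 : ℝ) • E72 + (1 / 1920 : ℝ) • E73 + (1 / 12 : ℝ) • E74)
    | _ => 0

set_option maxHeartbeats 4000000 in
/-- Both sides are expanded into words, of which there are thirteen in degree seven. -/
lemma basicSeries_agreeTo (c : ℝ) :
    AgreeTo 7 (basicSeries c) (flowSeries (c / 2) * coreSeries c * flowSeries (c / 2)) := by
  obtain ⟨y0, y1, y2, y3, y4, y5, y6, y7⟩ := coeff_Yser c
  have h := fun g => coeff_Yser_mul c g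
  simp only [forall_and] at h
  obtain ⟨h0, h1, h2, h3, h4, h5, h6, h7⟩ := h
  -- Peeling off one factor at a time keeps the expansion of the powers of `Yser c` sparse.
  have p1 : Yser c ^ 1 = Yser c := pow_one _
  have pk (k : ℕ) : Yser c ^ (k + 2) = Yser c * Yser c ^ (k + 1) := pow_succ' _ _
  intro n hn
  rw [basicSeries, fexp, coeff_mk]
  interval_cases n <;>
  simp [Finset.sum_range_succ, p1, pk, h0, h1, h2, h3, h4, h5, h6, h7,
    y0, y1, y2, y3, y4, y5, y6, y7, coeff_one, mul_add, Nat.factorial, -coeff_zero_eq_constantCoeff]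
  all_goals simp [Finset.sum_range_succ, coeff_mul_range, pow_succ,
    coeff_flowSeries, coreSeries, E71, E72, E73, E74, E52, E51, E61, E62, E31, E41,
    Ring.lie_def, Nat.factorial, mul_add, add_mul, mul_sub, sub_mul, mul_assoc,
    -coeff_zero_eq_constantCoeff]
  all_goals module

/-! ### The palindromic composition and its logarithm -/

/-- The series `e^{s h ad Y₁}` applied to `coreSeries c`, up to `O(h⁸)`. -/
def adSeries (s c : ℝ) : OpSeries :=
  PowerSeries.mk fun n => match n with
    | 0 => 1
    | 3 => c ^ 3 • E31
    | 4 => (s * c ^ 3) • E41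
    | 5 => c ^ 5 • (E51 + (1 / 24 : ℝ) • E52) + (s ^ 2 / 2 * c ^ 3) • E52
    | 6 => (c ^ 6 / 2) • (E31 * E31) + (s * c ^ 5) • (E61 + (1 / 24 : ℝ) • E62)
        + (s ^ 3 / 6 * c ^ 3) • E62
    | 7 => c ^ 7 • (E71 + (1 / 24 : ℝ) • E72 + (1 / 1920 : ℝ) • E73 + (1 / 12 : ℝ) • E74)
        + (s * (c ^ 6 / 2)) • (E41 * E31 + E31 * E41)
        + (s ^ 2 / 2 * c ^ 5) • (E72 + (1 / 24 : ℝ) • E73) + (s ^ 4 / 24 * c ^ 3) • E73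
    | _ => 0

set_option maxHeartbeats 4000000 in
/-- Conjugation by a flow is the exponential of `ad Y₁`. -/
lemma flow_conj_coreSeries (s c : ℝ) :
    AgreeTo 7 (flowSeries s * coreSeries c * flowSeries (-s)) (adSeries s c) := by
  intro n hn
  interval_cases n
  all_goals simp [Finset.sum_range_succ, coeff_mul_range, pow_succ, adSeries,
    coeff_flowSeries, coreSeries, E71, E72, E73, E74, E52, E51, E61, E62, E31, E41,
    Ring.lie_def, Nat.factorial, mul_add, add_mul, mul_sub, sub_mul, mul_assoc,
    -coeff_zero_eq_constantCoeff]
  all_goals module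

/-- The coordinates `w_{mn}(a)` as explicit polynomials in `a`. The multiples of
`2 * a ^ m + (1 - 2 * a) ^ m` come from the three cores, the other terms from the conjugation of the
outer two by the flow at time `∓ (1 - a) / 2`. -/
def wPoly (a : ℝ) : LieCoeffs where
  w31 := 2 * a ^ 3 + (1 - 2 * a) ^ 3
  w41 := 0
  w51 := 2 * a ^ 5 + (1 - 2 * a) ^ 5
  w52 := (2 * a ^ 5 + (1 - 2 * a) ^ 5) / 24 + ((1 - a) / 2) ^ 2 * a ^ 3
  w61 := 0
  w62 := 0
  w71 := 2 * a ^ 7 + (1 - 2 * a) ^ 7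
  w72 := (2 * a ^ 7 + (1 - 2 * a) ^ 7) / 24 + ((1 - a) / 2) ^ 2 * a ^ 5
  w73 := (2 * a ^ 7 + (1 - 2 * a) ^ 7) / 1920 + ((1 - a) / 2) ^ 2 * a ^ 5 / 24
    + ((1 - a) / 2) ^ 4 * a ^ 3 / 12
  w74 := (2 * a ^ 7 + (1 - 2 * a) ^ 7) / 12 + (1 - a) / 2 * a ^ 3 * (a ^ 3 + (1 - 2 * a) ^ 3)

/-- The series `e^{h³ W}` up to `O(h⁸)` when `h³ W` has the odd-degree coordinates of `v` and no
terms in even powers of `h`; the coordinates of `v` in even degrees are ignored. -/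
def midSeries (v : LieCoeffs) : OpSeries :=
  PowerSeries.mk fun n => match n with
    | 0 => 1
    | 3 => v.w31 • E31
    | 5 => v.w51 • E51 + v.w52 • E52
    | 6 => (v.w31 ^ 2 / 2) • (E31 * E31)
    | 7 => v.w71 • E71 + v.w72 • E72 + v.w73 • E73 + v.w74 • E74
    | _ => 0

set_option maxHeartbeats 4000000 in
/-- The even-degree terms linear in `E31`, `E51`, … cancel between the two outer factors, and the
products of the terms of degrees 3 and 4 combine into a multiple of the commutator `E74`. -/
lemma ad_core_ad (a : ℝ) :
    AgreeTo 7 (adSeries (-((1 - a) / 2)) a * coreSeries (1 - 2 * a) * adSeries ((1 - a) / 2) a)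
      (midSeries (wPoly a)) := by
  intro n hn
  have e : E74 = E31 * E41 - E41 * E31 := rfl
  interval_cases n
  all_goals simp [Finset.sum_range_succ, coeff_mul_range, adSeries, coreSeries, midSeries, wPoly,
    mul_add, add_mul, e, -coeff_zero_eq_constantCoeff]
  all_goals module

/-- `e^{-h Y₁ / 2} e^{Y(a h)} e^{Y((1 - 2 a) h)} e^{Y(a h)} e^{-h Y₁ / 2}` in explicit form: each
factor `e^{Y(c h)}` is `e^{c h Y₁ / 2}` times its core times `e^{c h Y₁ / 2}`, and collecting the
flows turns the two outer cores into conjugates by `e^{∓ (1 - a) h Y₁ / 2}`. -/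
lemma flow_comp_flow_agreeTo (a : ℝ) :
    AgreeTo 7 (flowSeries (-1 / 2) * compSeries a * flowSeries (-1 / 2))
      (midSeries (wPoly a)) := by
  have key : AgreeTo 7 (flowSeries (-1 / 2) * compSeries a * flowSeries (-1 / 2))
      (flowSeries (-1 / 2) *
        ((flowSeries (a / 2) * coreSeries a * flowSeries (a / 2)) *
          (flowSeries ((1 - 2 * a) / 2) * coreSeries (1 - 2 * a) * flowSeries ((1 - 2 * a) / 2)) *
          (flowSeries (a / 2) * coreSeries a * flowSeries (a / 2))) * flowSeries (-1 / 2)) :=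
    ((AgreeTo.refl _).mul (((basicSeries_agreeTo a).mul (basicSeries_agreeTo _)).mul
      (basicSeries_agreeTo a))).mul (AgreeTo.refl _)
  refine key.trans (AgreeTo.trans ?_ (ad_core_ad a))
  have h1 : flowSeries (-1 / 2) * flowSeries (a / 2) = flowSeries (-((1 - a) / 2)) := by
    rw [flowSeries_mul]; ring_nf
  have h2 : flowSeries (a / 2) * flowSeries ((1 - 2 * a) / 2) = flowSeries (- -((1 - a) / 2)) := by
    rw [flowSeries_mul]; ring_nf
  have h3 : flowSeries ((1 - 2 * a) / 2) * flowSeries (a / 2) = flowSeries ((1 - a) / 2) := by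
    rw [flowSeries_mul]; ring_nf
  have h4 : flowSeries (a / 2) * flowSeries (-1 / 2) = flowSeries (-((1 - a) / 2)) := by
    rw [flowSeries_mul]; ring_nf
  have e : flowSeries (-1 / 2) *
        ((flowSeries (a / 2) * coreSeries a * flowSeries (a / 2)) *
          (flowSeries ((1 - 2 * a) / 2) * coreSeries (1 - 2 * a) * flowSeries ((1 - 2 * a) / 2)) *
          (flowSeries (a / 2) * coreSeries a * flowSeries (a / 2))) * flowSeries (-1 / 2) =
      (flowSeries (-1 / 2) * flowSeries (a / 2)) * coreSeries a *
        (flowSeries (a / 2) * flowSeries ((1 - 2 * a) / 2)) * coreSeries (1 - 2 * a) *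
        ((flowSeries ((1 - 2 * a) / 2) * flowSeries (a / 2)) * coreSeries a *
          (flowSeries (a / 2) * flowSeries (-1 / 2))) := by
    simp only [mul_assoc]
  rw [e, h1, h2, h3, h4]
  exact ((flow_conj_coreSeries _ a).mul (AgreeTo.refl _)).mul (flow_conj_coreSeries _ a)

lemma coeff_flog_midSeries (v : LieCoeffs) :
    coeff 0 (flog (midSeries v)) = 0 ∧ coeff 1 (flog (midSeries v)) = 0 ∧
    coeff 2 (flog (midSeries v)) = 0 ∧ coeff 3 (flog (midSeries v)) = v.w31 • E31 ∧
    coeff 4 (flog (midSeries v)) = 0 ∧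
    coeff 5 (flog (midSeries v)) = v.w51 • E51 + v.w52 • E52 ∧
    coeff 6 (flog (midSeries v)) = 0 ∧
    coeff 7 (flog (midSeries v)) =
      v.w71 • E71 + v.w72 • E72 + v.w73 • E73 + v.w74 • E74 := by
  set N := midSeries v - 1 with hN
  have n0 : coeff 0 N = 0 := by simp [hN, midSeries, coeff_one, -coeff_zero_eq_constantCoeff]
  have n1 : coeff 1 N = 0 := by simp [hN, midSeries, coeff_one]
  have n2 : coeff 2 N = 0 := by simp [hN, midSeries, coeff_one]
  have n3 : coeff 3 N = v.w31 • E31 := by simp [hN, midSeries, coeff_one]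
  have n4 : coeff 4 N = 0 := by simp [hN, midSeries, coeff_one]
  have n5 : coeff 5 N = v.w51 • E51 + v.w52 • E52 := by simp [hN, midSeries, coeff_one]
  have n6 : coeff 6 N = (v.w31 ^ 2 / 2) • (E31 * E31) := by simp [hN, midSeries, coeff_one]
  have n7 : coeff 7 N = v.w71 • E71 + v.w72 • E72 + v.w73 • E73 + v.w74 • E74 := by
    simp [hN, midSeries, coeff_one]
  have p1 : N ^ 1 = N := pow_one _
  have pk (k : ℕ) : N ^ (k + 2) = N * N ^ (k + 1) := pow_succ' _ _
  -- `N` starts in degree `3`, so `N * g` is sparse and the powers `N ^ k`, `k ≥ 3`, do not count.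
  have h (g : OpSeries) : coeff 0 (N * g) = 0 ∧ coeff 1 (N * g) = 0 ∧ coeff 2 (N * g) = 0 ∧
      coeff 3 (N * g) = coeff 3 N * coeff 0 g ∧ coeff 4 (N * g) = coeff 3 N * coeff 1 g ∧
      coeff 5 (N * g) = coeff 3 N * coeff 2 g + coeff 5 N * coeff 0 g ∧
      coeff 6 (N * g) = coeff 3 N * coeff 3 g + coeff 5 N * coeff 1 g + coeff 6 N * coeff 0 g ∧
      coeff 7 (N * g) = coeff 3 N * coeff 4 g + coeff 5 N * coeff 2 g + coeff 6 N * coeff 1 g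
        + coeff 7 N * coeff 0 g := by
    simp [coeff_mul_range, Finset.sum_range_succ, n0, n1, n2, n4, -coeff_zero_eq_constantCoeff]
  simp only [forall_and] at h
  obtain ⟨h0, h1, h2, h3, h4, h5, h6, h7⟩ := h
  refine ⟨?_, ?_, ?_, ?_, ?_, ?_, ?_, ?_⟩ <;> rw [flog, coeff_mk, ← hN]
  all_goals simp [Finset.sum_Icc_succ_top, p1, pk, h0, h1, h2, h3, h4, h5, h6, h7,
    n0, n1, n2, n3, n4, n5, n6, n7, -coeff_zero_eq_constantCoeff]
  module

lemma isLogExpansion_wPoly (a : ℝ) : IsLogExpansion a (wPoly a) := by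
  obtain ⟨h0, h1, h2, h3, h4, h5, h6, h7⟩ := coeff_flog_midSeries (wPoly a)
  have H := (flow_comp_flow_agreeTo a).flog
  refine ⟨?_, ?_, ?_, ?_, ?_, ?_, ?_, ?_⟩ <;> rw [logSeries, H _ (by norm_num)]
  · exact h0
  · exact h1
  · exact h2
  · exact h3
  · rw [h4]; simp [wPoly]
  · exact h5
  · rw [h6]; simp [wPoly]
  · exact h7

/-! ### Word coefficients and uniqueness of the coordinates -/

/-- The coefficient of the word `Y_{2 l₁ + 1} Y_{2 l₂ + 1} ⋯` in a noncommutative polynomial. -/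
def wordCoeff (l : List ℕ) : Op →ₗ[ℝ] ℝ where
  toFun p := (FreeAlgebra.equivMonoidAlgebraFreeMonoid (R := ℝ) p).coeff (FreeMonoid.ofList l)
  map_add' p q := by simp
  map_smul' c p := by simp

lemma equivMonoidAlgebra_Y (k : ℕ) :
    FreeAlgebra.equivMonoidAlgebraFreeMonoid (R := ℝ) (Y k) =
      MonoidAlgebra.single (FreeMonoid.of k) 1 :=
  FreeAlgebra.lift_ι_apply _ _

lemma wordCoeff_Y (l : List ℕ) (k : ℕ) : wordCoeff l (Y k) = if [k] = l then 1 else 0 := by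
  change MonoidAlgebra.coeff (FreeAlgebra.equivMonoidAlgebraFreeMonoid (R := ℝ) (Y k)) _ = _
  rw [equivMonoidAlgebra_Y, MonoidAlgebra.coeff_single]
  classical
  rw [Finsupp.single_apply]
  exact if_congr Iff.rfl rfl rfl

lemma wordCoeff_nil_one : wordCoeff [] 1 = 1 := by
  change MonoidAlgebra.coeff (FreeAlgebra.equivMonoidAlgebraFreeMonoid (R := ℝ) 1) _ = _
  rw [map_one, MonoidAlgebra.one_def, MonoidAlgebra.coeff_single]
  exact Finsupp.single_eq_same

lemma wordCoeff_cons_Y_mul (j : ℕ) (l : List ℕ) (k : ℕ) (p : Op) :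
    wordCoeff (j :: l) (Y k * p) = if k = j then wordCoeff l p else 0 := by
  change MonoidAlgebra.coeff (FreeAlgebra.equivMonoidAlgebraFreeMonoid (R := ℝ) (Y k * p)) _ = _
  rw [map_mul, equivMonoidAlgebra_Y]
  split_ifs with h
  · subst h
    exact (MonoidAlgebra.coeff_single_mul_mul _ _ (FreeMonoid.of k) (FreeMonoid.ofList l)).trans
      (one_mul _)
  · refine MonoidAlgebra.coeff_single_mul_of_forall_mul_ne _ _ fun m hm => h ?_
    exact (List.cons.inj hm).1

/-- The `E_{mn}` are separated by their coefficients at suitable words. -/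
lemma wordCoeff_E :
    wordCoeff [1] E31 = 1 ∧ wordCoeff [0, 1] E41 = 1 ∧
    (wordCoeff [2] E51 = 1 ∧ wordCoeff [2] E52 = 0) ∧
    (wordCoeff [0, 0, 1] E51 = 0 ∧ wordCoeff [0, 0, 1] E52 = 1) ∧
    (wordCoeff [0, 2] E61 = 1 ∧ wordCoeff [0, 2] E62 = 0) ∧
    (wordCoeff [0, 0, 0, 1] E61 = 0 ∧ wordCoeff [0, 0, 0, 1] E62 = 1) ∧
    (wordCoeff [3] E71 = 1 ∧ wordCoeff [3] E72 = 0 ∧ wordCoeff [3] E73 = 0 ∧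
      wordCoeff [3] E74 = 0) ∧
    (wordCoeff [0, 0, 2] E71 = 0 ∧ wordCoeff [0, 0, 2] E72 = 1 ∧ wordCoeff [0, 0, 2] E73 = 0 ∧
      wordCoeff [0, 0, 2] E74 = 0) ∧
    (wordCoeff [0, 0, 0, 0, 1] E71 = 0 ∧ wordCoeff [0, 0, 0, 0, 1] E72 = 0 ∧
      wordCoeff [0, 0, 0, 0, 1] E73 = 1 ∧ wordCoeff [0, 0, 0, 0, 1] E74 = 0) ∧
    (wordCoeff [0, 1, 1] E71 = 0 ∧ wordCoeff [0, 1, 1] E72 = 0 ∧ wordCoeff [0, 1, 1] E73 = 0 ∧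
      wordCoeff [0, 1, 1] E74 = -1) := by
  simp [E71, E72, E73, E74, E52, E51, E61, E62, E31, E41, Ring.lie_def, mul_sub, sub_mul,
    mul_assoc, wordCoeff_Y, wordCoeff_cons_Y_mul]

lemma wordCoeff_E31_mul_E31 : wordCoeff [1, 1] (E31 * E31) = 1 := by
  simp [E31, wordCoeff_Y, wordCoeff_cons_Y_mul]

lemma IsLogExpansion.unique {a : ℝ} {u v : LieCoeffs} (hu : IsLogExpansion a u)
    (hv : IsLogExpansion a v) : u = v := by
  obtain ⟨e31, e41, ⟨e51, e51'⟩, ⟨e52, e52'⟩, ⟨e61, e61'⟩, ⟨e62, e62'⟩, ⟨e1, e2, e3, e4⟩,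
    ⟨f1, f2, f3, f4⟩, ⟨g1, g2, g3, g4⟩, ⟨i1, i2, i3, i4⟩⟩ := wordCoeff_E
  have h3 := hu.deg3.symm.trans hv.deg3
  have h4 := hu.deg4.symm.trans hv.deg4
  have h5 := hu.deg5.symm.trans hv.deg5
  have h6 := hu.deg6.symm.trans hv.deg6
  have h7 := hu.deg7.symm.trans hv.deg7
  ext
  · simpa [e31] using congrArg (wordCoeff [1]) h3
  · simpa [e41] using congrArg (wordCoeff [0, 1]) h4
  · simpa [e51, e51'] using congrArg (wordCoeff [2]) h5
  · simpa [e52, e52'] using congrArg (wordCoeff [0, 0, 1]) h5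
  · simpa [e61, e61'] using congrArg (wordCoeff [0, 2]) h6
  · simpa [e62, e62'] using congrArg (wordCoeff [0, 0, 0, 1]) h6
  · simpa [e1, e2, e3, e4] using congrArg (wordCoeff [3]) h7
  · simpa [f1, f2, f3, f4] using congrArg (wordCoeff [0, 0, 2]) h7
  · simpa [g1, g2, g3, g4] using congrArg (wordCoeff [0, 0, 0, 0, 1]) h7
  · simpa [i1, i2, i3, i4] using congrArg (wordCoeff [0, 1, 1]) h7

lemma isLogExpansion_w (a : ℝ) : IsLogExpansion a (w a) :=
  Classical.epsilon_spec ⟨_, isLogExpansion_wPoly a⟩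

lemma w_eq (a : ℝ) : w a = wPoly a := (isLogExpansion_w a).unique (isLogExpansion_wPoly a)

/-! ### Linear relations between the order conditions -/

section Relations

variable {k : ℕ} (b a : Fin k → ℝ)

/-- Modulo `w₃₁, w₅₁, w₅₂, w₃₁²`, the polynomial `w₇₂` is an affine function of `w₇₁`. -/
lemma G72_eq : G72 b a = -(5 / 4536) * G00 b + 1 / 162 * G31 b a - 5 / 216 * G51 b a
    + 2 / 9 * G52 b a + 7 / 648 * Gt63 b a + 5 / 126 * G71 b a := by
  simp only [G72, G00, G31, G51, G52, Gt63, G71, Finset.mul_sum, ← Finset.sum_add_distrib,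
    ← Finset.sum_sub_distrib]
  refine Finset.sum_congr rfl fun i _ => ?_
  rw [w_eq, wPoly]
  ring

lemma G73_eq : G73 b a = -(1 / 90720) * G00 b + 1 / 10368 * G31 b a - 1 / 1080 * G51 b a
    + 1 / 72 * G52 b a + 1 / 2592 * Gt63 b a + 1 / 2520 * G71 b a := by
  simp only [G73, G00, G31, G51, G52, Gt63, G71, Finset.mul_sum, ← Finset.sum_add_distrib,
    ← Finset.sum_sub_distrib]
  refine Finset.sum_congr rfl fun i _ => ?_
  rw [w_eq, wPoly]
  ring

lemma G74_eq : G74 b a = -(1 / 648) * G00 b + 11 / 648 * G31 b a - 2 / 27 * G51 b a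
    + 1 / 9 * G52 b a + 53 / 648 * Gt63 b a + 1 / 18 * G71 b a := by
  simp only [G74, G00, G31, G51, G52, Gt63, G71, Finset.mul_sum, ← Finset.sum_add_distrib,
    ← Finset.sum_sub_distrib]
  refine Finset.sum_congr rfl fun i _ => ?_
  rw [w_eq, wPoly]
  ring

lemma Gt87_Gt88_relation :
    -(1 / 15) * (1 / 2 * Gt87 b a) + 2 * (1 / 2 * Gt88 b a) + 1 / 30 * G71 b a + G72 b a
        + 6 * G73 b a - 3 / 2 * G74 b a =
      -(7 / 960) * G31 b a + 1 / 24 * G51 b a + 1 / 4 * G52 b a - 1 / 12 * Gt63 b a := by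
  simp only [G72, G73, G74, G31, G51, G52, Gt63, Gt87, Gt88, G71, Finset.mul_sum,
    ← Finset.sum_add_distrib, ← Finset.sum_sub_distrib]
  refine Finset.sum_congr rfl fun i _ => ?_
  rw [w_eq, wPoly]
  ring

end Relations

/-! ### The formal barrier -/

/-- Stripping the half flows off both sides of `Ψ(h) = e^{h Y₁} + O(h⁸)` leaves
`∑ i, b i • e^{h³ W(h; aᵢ)} = 1 + O(h⁸)`. -/
lemma HasFormalOrder.sum_midSeries {k : ℕ} {b a : Fin k → ℝ} (h : HasFormalOrder 7 b a) {n : ℕ}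
    (hn : n ≤ 7) : ∑ i, b i • coeff n (midSeries (wPoly (a i))) = coeff n (1 : OpSeries) := by
  have h1 : AgreeTo 7 (flowSeries (-1 / 2) * methodSeries b a * flowSeries (-1 / 2))
      (flowSeries (-1 / 2) * flowSeries 1 * flowSeries (-1 / 2)) :=
    ((AgreeTo.refl _).mul h).mul (AgreeTo.refl _)
  rw [flowSeries_mul, flowSeries_mul, show (-1 / 2 + 1 + -1 / 2 : ℝ) = 0 by norm_num,
    flowSeries_zero] at h1
  rw [← h1 n hn, methodSeries, Finset.mul_sum, Finset.sum_mul, map_sum]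
  refine Finset.sum_congr rfl fun i _ => ?_
  rw [← flow_comp_flow_agreeTo (a i) n hn, mul_smul_comm, smul_mul_assoc]
  rfl

/-- Order seven would give the sixth-order conditions together with `G₇₁ = G₇₂ = 0`. -/
lemma not_hasFormalOrder_seven {k : ℕ} (b a : Fin k → ℝ) : ¬ HasFormalOrder 7 b a := by
  intro h
  obtain ⟨e31, -, ⟨e51, e51'⟩, ⟨e52, e52'⟩, -, -, ⟨e1, e2, e3, e4⟩, ⟨f1, f2, f3, f4⟩, -, -⟩ :=
    wordCoeff_E
  have c (l : List ℕ) (n : ℕ) (hn : n ≤ 7) := congrArg (wordCoeff l) (h.sum_midSeries hn)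
  simp only [map_sum, map_smul] at c
  have g00 : G00 b = 1 := by
    simpa [midSeries, wordCoeff_nil_one, G00, -coeff_zero_eq_constantCoeff] using
      c [] 0 (by norm_num)
  have g31 : G31 b a = 0 := by
    simpa [midSeries, coeff_one, e31, G31, w_eq] using c [1] 3 (by norm_num)
  have g51 : G51 b a = 0 := by
    simpa [midSeries, coeff_one, e51, e51', G51, w_eq] using c [2] 5 (by norm_num)
  have g52 : G52 b a = 0 := by
    simpa [midSeries, coeff_one, e52, e52', G52, w_eq] using c [0, 0, 1] 5 (by norm_num)
  have g63 : Gt63 b a = 0 := by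
    have := c [1, 1] 6 (by norm_num)
    simpa [midSeries, coeff_one, wordCoeff_E31_mul_E31, Gt63, w_eq, ← mul_div_assoc,
      ← Finset.sum_div] using this
  have g71 : G71 b a = 0 := by
    simpa [midSeries, coeff_one, e1, e2, e3, e4, G71, w_eq] using c [3] 7 (by norm_num)
  have g72 : G72 b a = 0 := by
    simpa [midSeries, coeff_one, f1, f2, f3, f4, G72, w_eq] using c [0, 0, 2] 7 (by norm_num)
  have := G72_eq b a
  rw [g72, g00, g31, g51, g52, g63, g71] at this
  norm_num at this

end Series

section Numerical

open Asymptotics Filter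

/-! ### The barrier on differential equations -/

lemma eq_zero_of_mul_pow_isBigO {c : ℝ} {n N : ℕ} (hn : n < N)
    (h : (fun t : ℝ => c * t ^ n) =O[𝓝 0] fun t => t ^ N) : c = 0 := by
  by_contra hc
  have h1 : (fun t : ℝ => c * t ^ n) =o[𝓝 0] fun t => t ^ n :=
    h.trans_isLittleO (isLittleO_pow_pow hn)
  rw [isLittleO_const_mul_left_iff hc] at h1
  refine isLittleO_irrefl ?_ h1
  have h2 : ∀ᶠ t : ℝ in 𝓝[≠] 0, t ^ n ≠ 0 := by
    filter_upwards [self_mem_nhdsWithin] with t ht using pow_ne_zero n ht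
  exact h2.frequently.filter_mono nhdsWithin_le_nhds

/-- The map `(p, q) ↦ (p + α(h), q + β(h, p))` of the plane. With `α(h) = κ h` and `β = 0` it is the
flow of the constant field `(κ, 0)`. -/
def shearMap (α : ℝ → ℝ) (β : ℝ → ℝ → ℝ) (h : ℝ) (x : EuclideanSpace ℝ (Fin 2)) :
    EuclideanSpace ℝ (Fin 2) :=
  x + α h • EuclideanSpace.single 0 1 + β h (x 0) • EuclideanSpace.single 1 1

section Shear

variable (α : ℝ → ℝ) (β : ℝ → ℝ → ℝ)

lemma shearMap_apply_zero (h : ℝ) (x : EuclideanSpace ℝ (Fin 2)) :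
    shearMap α β h x 0 = x 0 + α h := by
  simp [shearMap]

lemma shearMap_apply_one (h : ℝ) (x : EuclideanSpace ℝ (Fin 2)) :
    shearMap α β h x 1 = x 1 + β h (x 0) := by
  simp [shearMap]

lemma isFlow_shearMap (κ : ℝ) :
    IsFlow (fun _ => κ • EuclideanSpace.single 0 1)
      (shearMap (fun t => κ * t) fun _ _ => 0) where
  zero x := by simp [shearMap]
  deriv t x := by
    have h : HasDerivAt (fun s : ℝ => κ * s) κ t := by
      simpa using (hasDerivAt_id t).const_mul κ
    have h' := (h.smul_const (EuclideanSpace.single (0 : Fin 2) (1 : ℝ))).const_add x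
    simpa only [shearMap, zero_smul, add_zero] using h'

variable {α β}

lemma isBasicScheme_shearMap {κ : ℝ} (hα : ContDiff ℝ ∞ α)
    (hβ : ContDiff ℝ ∞ fun p : ℝ × ℝ => β p.1 p.2) (α_odd : ∀ h, α (-h) = -α h)
    (β_symm : ∀ h s, β (-h) (s + α h) = -β h s)
    (α_order : (fun h => α h - κ * h) =O[𝓝 0] fun h : ℝ => h ^ 3)
    (β_order : ∀ s, (fun h => β h s) =O[𝓝 0] fun h : ℝ => h ^ 3) :
    IsBasicScheme (shearMap (fun t => κ * t) fun _ _ => 0) (shearMap α β) where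
  smooth := by
    have h0 : ContDiff ℝ ∞ fun p : ℝ × EuclideanSpace ℝ (Fin 2) => p.2 0 :=
      (EuclideanSpace.proj 0 : EuclideanSpace ℝ (Fin 2) →L[ℝ] ℝ).contDiff.comp contDiff_snd
    exact (contDiff_snd.add ((hα.comp contDiff_fst).smul contDiff_const)).add
      ((hβ.comp (contDiff_fst.prodMk h0)).smul contDiff_const)
  symmetric h x := by
    ext i
    fin_cases i
    · simp [shearMap_apply_zero, α_odd]
    · simp [shearMap_apply_zero, shearMap_apply_one, β_symm]
  order_two x := by
    have e : (fun h => shearMap α β h x - shearMap (fun t => κ * t) (fun _ _ => 0) h x) =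
        fun h => (α h - κ * h) • EuclideanSpace.single 0 1
          + β h (x 0) • EuclideanSpace.single 1 1 := by
      ext h : 1
      simp only [shearMap]
      module
    rw [e]
    have aux {u : ℝ → ℝ} (hu : u =O[𝓝 0] fun h : ℝ => h ^ 3) (v : EuclideanSpace ℝ (Fin 2)) :
        (fun h => u h • v) =O[𝓝 0] fun h : ℝ => h ^ 3 := by
      simpa using hu.smul (isBigO_const_const v (one_ne_zero' ℝ) (𝓝 0))
    exact (aux α_order _).add (aux (β_order _) _)

/-- What order `N` says, at the origin, about a shear integrator of a constant vector field. -/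
lemma HasOrder.shearMap {k N : ℕ} {b a : Fin k → ℝ} (H : HasOrder N b a) {κ : ℝ}
    (hS : IsBasicScheme (shearMap (fun t => κ * t) fun _ _ => 0) (shearMap α β)) :
    ((fun h => ∑ i, b i * (α (a i * h) + α ((1 - 2 * a i) * h) + α (a i * h)) - κ * h)
        =O[𝓝 0] fun h : ℝ => h ^ (N + 1)) ∧
    ((fun h => ∑ i, b i * (β (a i * h) 0 + β ((1 - 2 * a i) * h) (α (a i * h))
          + β (a i * h) (α (a i * h) + α ((1 - 2 * a i) * h))))
        =O[𝓝 0] fun h : ℝ => h ^ (N + 1)) := by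
  have key := H 2 _ _ _ contDiff_const (isFlow_shearMap κ) hS 0
  have coord (j : Fin 2) := ((EuclideanSpace.proj j :
    EuclideanSpace ℝ (Fin 2) →L[ℝ] ℝ).isBigO_comp _ _).trans key
  constructor
  · refine (coord 0).congr_left fun h => ?_
    simp [method, shearMap_apply_zero, WithLp.ofLp_sum]
  · refine (coord 1).congr_left fun h => ?_
    simp [method, shearMap_apply_zero, shearMap_apply_one, WithLp.ofLp_sum]

end Shear

/-- Order seven, tested on `p' = 1, q' = 0` with the integrator
`(p, q) ↦ (p + h, q + h ^ (2 l + 3) (p + h / 2) ^ j)`. -/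
lemma HasOrder.moment_eq_zero {k : ℕ} {b a : Fin k → ℝ} (H : HasOrder 7 b a) (l j : ℕ)
    (hlj : 2 * l + 3 + j < 8) :
    ∑ i, b i = 1 ∧
    ∑ i, b i * (a i ^ (2 * l + 3) * (a i / 2) ^ j + (1 - 2 * a i) ^ (2 * l + 3) * (1 / 2) ^ j
      + a i ^ (2 * l + 3) * (1 - a i / 2) ^ j) = 0 := by
  have hS : IsBasicScheme (PalComp.shearMap (fun t => 1 * t) fun _ _ => 0)
      (PalComp.shearMap (fun h => h) fun h s => h ^ (2 * l + 3) * (s + h / 2) ^ j) := by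
    apply isBasicScheme_shearMap
    · exact contDiff_id
    · fun_prop
    · exact fun h => rfl
    · intro h s
      rw [Odd.neg_pow ⟨l + 1, by ring⟩]
      ring
    · simpa using isBigO_zero _ _
    · intro s
      have h1 : (fun h : ℝ => h ^ (2 * l) * (s + h / 2) ^ j) =O[𝓝 0] fun _ => (1 : ℝ) :=
        (Continuous.tendsto (by fun_prop) 0).isBigO_one ℝ
      refine ((isBigO_refl (fun h : ℝ => h ^ 3) _).mul h1).congr (fun h => ?_) fun h => mul_one _
      ring
  obtain ⟨h1, h2⟩ := H.shearMap hS
  constructor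
  · refine sub_eq_zero.1 (eq_zero_of_mul_pow_isBigO (n := 1) (by norm_num)
      (h1.congr_left fun h => ?_))
    rw [pow_one, sub_mul, Finset.sum_mul]
    congr 1
    exact Finset.sum_congr rfl fun i _ => by ring
  · refine eq_zero_of_mul_pow_isBigO hlj (h2.congr_left fun h => ?_)
    rw [Finset.sum_mul]
    refine Finset.sum_congr rfl fun i _ => ?_
    have e1 : 0 + a i * h / 2 = a i / 2 * h := by ring
    have e2 : a i * h + (1 - 2 * a i) * h / 2 = 1 / 2 * h := by ring
    have e3 : a i * h + (1 - 2 * a i) * h + a i * h / 2 = (1 - a i / 2) * h := by ring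
    rw [e1, e2, e3]
    simp only [mul_pow]
    ring

/-- Order seven, tested on the zero field with the integrator
`(p, q) ↦ (p + h³, q + h³ p + h⁶ / 2)`, the time `h³` map of `p' = 1, q' = p`. -/
lemma HasOrder.sum_sq_eq_zero {k : ℕ} {b a : Fin k → ℝ} (H : HasOrder 7 b a) :
    ∑ i, b i * (2 * a i ^ 3 + (1 - 2 * a i) ^ 3) ^ 2 = 0 := by
  have hS : IsBasicScheme (PalComp.shearMap (fun t => 0 * t) fun _ _ => 0)
      (PalComp.shearMap (fun h => h ^ 3) fun h s => h ^ 3 * (s + h ^ 3 / 2)) := by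
    apply isBasicScheme_shearMap
    · fun_prop
    · fun_prop
    · intro h; ring
    · intro h s; ring
    · simpa using isBigO_refl _ _
    · intro s
      have h1 : (fun h : ℝ => s + h ^ 3 / 2) =O[𝓝 0] fun _ => (1 : ℝ) :=
        (Continuous.tendsto (by fun_prop) 0).isBigO_one ℝ
      simpa using (isBigO_refl (fun h : ℝ => h ^ 3) _).mul h1
  have h2 := (H.shearMap hS).2
  have : (∑ i, b i * (2 * a i ^ 3 + (1 - 2 * a i) ^ 3) ^ 2) / 2 = 0 := by
    refine eq_zero_of_mul_pow_isBigO (n := 6) (by norm_num) (h2.congr_left fun h => ?_)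
    rw [Finset.sum_div, Finset.sum_mul]
    exact Finset.sum_congr rfl fun i _ => by ring
  linarith

/-- Order seven would give `∑ b i = 1` and `∑ b i = 0`. -/
lemma not_hasOrder_seven {k : ℕ} (b a : Fin k → ℝ) : ¬ HasOrder 7 b a := by
  intro H
  obtain ⟨h0, h30⟩ := H.moment_eq_zero 0 0 (by norm_num)
  have h50 := (H.moment_eq_zero 1 0 (by norm_num)).2
  have h70 := (H.moment_eq_zero 2 0 (by norm_num)).2
  have h32 := (H.moment_eq_zero 0 2 (by norm_num)).2
  have h52 := (H.moment_eq_zero 1 2 (by norm_num)).2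
  have hsq := H.sum_sq_eq_zero
  -- The constant `1` is a linear combination of the six polynomials in `aᵢ` whose sums vanish; the
  -- coefficients are the solution of the linear system given by the powers of `aᵢ`.
  have key : ∑ i, b i =
      -(98 / 5) * (∑ i, b i * (a i ^ (2 * 0 + 3) * (a i / 2) ^ 0
        + (1 - 2 * a i) ^ (2 * 0 + 3) * (1 / 2) ^ 0 + a i ^ (2 * 0 + 3) * (1 - a i / 2) ^ 0))
      + 504 / 5 * (∑ i, b i * (a i ^ (2 * 1 + 3) * (a i / 2) ^ 0
        + (1 - 2 * a i) ^ (2 * 1 + 3) * (1 / 2) ^ 0 + a i ^ (2 * 1 + 3) * (1 - a i / 2) ^ 0))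
      - 9 / 5 * (∑ i, b i * (a i ^ (2 * 2 + 3) * (a i / 2) ^ 0
        + (1 - 2 * a i) ^ (2 * 2 + 3) * (1 / 2) ^ 0 + a i ^ (2 * 2 + 3) * (1 - a i / 2) ^ 0))
      + 504 / 5 * (∑ i, b i * (a i ^ (2 * 0 + 3) * (a i / 2) ^ 2
        + (1 - 2 * a i) ^ (2 * 0 + 3) * (1 / 2) ^ 2 + a i ^ (2 * 0 + 3) * (1 - a i / 2) ^ 2))
      - 2268 / 5 * (∑ i, b i * (a i ^ (2 * 1 + 3) * (a i / 2) ^ 2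
        + (1 - 2 * a i) ^ (2 * 1 + 3) * (1 / 2) ^ 2 + a i ^ (2 * 1 + 3) * (1 - a i / 2) ^ 2))
      + 49 / 5 * ∑ i, b i * (2 * a i ^ 3 + (1 - 2 * a i) ^ 3) ^ 2 := by
    simp only [Finset.mul_sum, ← Finset.sum_add_distrib, ← Finset.sum_sub_distrib]
    exact Finset.sum_congr rfl fun i _ => by ring
  rw [h0, h30, h50, h70, h32, h52, hsq] at key
  norm_num at key

end Numerical

end PalComp

end

theorem mainTheorem2 :
    -- the coordinates `w_{mn}(a)` exist and are unique
    (∀ a : ℝ, PalComp.IsLogExpansion a (PalComp.w a) ∧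
      ∀ v : PalComp.LieCoeffs, PalComp.IsLogExpansion a v → v = PalComp.w a) ∧
    ∀ (k : ℕ) (b a : Fin k → ℝ),
      -- linear relations under the sixth-order conditions
      (PalComp.OrderSixConditions b a →
        PalComp.G72 b a = -(5 / 4536) + 5 / 126 * PalComp.G71 b a ∧
        PalComp.G73 b a = -(1 / 90720) + 1 / 2520 * PalComp.G71 b a ∧
        PalComp.G74 b a = -(1 / 648) + 1 / 18 * PalComp.G71 b a ∧
        -(1 / 15) * (1 / 2 * PalComp.Gt87 b a) + 2 * (1 / 2 * PalComp.Gt88 b a)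
            + 1 / 30 * PalComp.G71 b a + PalComp.G72 b a + 6 * PalComp.G73 b a
            - 3 / 2 * PalComp.G74 b a = 0 ∧
        (PalComp.G71 b a = 0 → ¬ (PalComp.Gt87 b a = 0 ∧ PalComp.Gt88 b a = 0)) ∧
        (PalComp.G72 b a = 0 ∧ PalComp.G73 b a = 0 ∧ PalComp.G74 b a = 0 →
          PalComp.G71 b a = 1 / 36)) ∧
      -- the barrier: order 7 is never reached, formally or on differential equations
      ¬ PalComp.HasFormalOrder 7 b a ∧
      ¬ PalComp.HasOrder 7 b a := by
  refine ⟨fun a => ⟨PalComp.isLogExpansion_w a,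
    fun v hv => hv.unique (PalComp.isLogExpansion_w a)⟩, fun k b a => ⟨?_,
    PalComp.not_hasFormalOrder_seven b a, PalComp.not_hasOrder_seven b a⟩⟩
  rintro ⟨g00, g31, g51, g52, g63⟩
  have h72 := PalComp.G72_eq b a
  have h73 := PalComp.G73_eq b a
  have h74 := PalComp.G74_eq b a
  have hr := PalComp.Gt87_Gt88_relation b a
  rw [g00, g31, g51, g52, g63] at h72 h73 h74
  rw [g31, g51, g52, g63] at hr
  refine ⟨by linarith, by linarith, by linarith, by linarith, ?_, ?_⟩
  · rintro h71 ⟨h87, h88⟩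
    linarith
  · rintro ⟨z72, -, -⟩
    linarith
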